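/- Let $M$ be an $m$-dimensional smooth ($C^\infty$) manifold and let $\mathfrak TM$ be its big-tangent manifold, i.e. the total space of $TM\oplus T^*M$, whose points are the triples $(x,y,z)$ with $x\in M$, $y\in T_xM$, $z\in T_x^*M$. Let $p:\mathfrak TM\to M$, $p_1:\mathfrak TM\to TM$, $p_2:\mathfrak TM\to T^*M$ be the natural projections, and put $\mathcal V=\ker dp$, $\mathcal V_1=\ker dp_2$, $\mathcal V_2=\ker dp_1$, so that $\mathcal V=\mathcal V_1\oplus\mathcal V_2$. Let $\mathcal H$ be a horizontal bundle, i.e. a smooth subbundle of $T\mathfrak TM$ with $T\mathfrak TM=\mathcal H\oplus\mathcal V$, let $pr_{\mathcal H},pr_{\mathcal V}$ be the corresponding projections, and let $R_{\mathcal H}(Z_1,Z_2)=pr_{\mathcal V}[pr_{\mathcal H}Z_1,pr_{\mathcal H}Z_2]$ be the Ehresmann curvature of $\mathcal H$. For a smooth linear connection $\nabla$ on $\mathfrak TM$ write $T_\nabla(Z_1,Z_2)=\nabla_{Z_1}Z_2-\nabla_{Z_2}Z_1-[Z_1,Z_2]$ and $R_\nabla(Z_1,Z_2)Z_3=\nabla_{Z_1}\nabla_{Z_2}Z_3-\nabla_{Z_2}\nabla_{Z_1}Z_3-\nabla_{[Z_1,Z_2]}Z_3$.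 The connection $\nabla$ is called a Bott connection (a connection with no mixed torsion) if it preserves $\mathcal H$ and $\mathcal V$ and $T_\nabla(X,Y)=0$ for all $X\in\mathcal H$, $Y\in\mathcal V$. It is called a connection with no multi-mixed torsion if it is a Bott connection that also preserves $\mathcal V_1$ and $\mathcal V_2$ and satisfies $T_\nabla(Y_a,Y_{a'})=0$ for all $Y_a\in\mathcal V_a$, $Y_{a'}\in\mathcal V_{a'}$, whenever $\{a,a'\}=\{1,2\}$. A vector field $X$ on an open set $U\subseteq\mathfrak TM$ is projectable if there is a field $Z$ of tangent vectors on $M$ with $dp(X_q)=Z_{p(q)}$ for all $q\in U$. Let $\nabla$ be a Bott connection, let $U\subseteq\mathfrak TM$ be open, let $X,X'$ be smooth vector fields on $U$ with values in $\mathcal H$, and let $Y,Y'$ be smooth vector fields on $U$ with values in $\mathcal V$. Then on $U$: (i) $R_\nabla(Y,Y')X=0$; (ii) if $X$ and $X'$ are projectable, then $R_\nabla(Y,X)X'=pr_{\mathcal H}[Y,\nabla_XX']$; (iii) if $X$ and $X'$ are projectable, then $R_\nabla(X,X')Y=T_\nabla(Y,R_{\mathcal H}(X,X'))-\nabla_Y(R_{\mathcal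 H}(X,X'))$. (iv) If moreover $\nabla$ has no multi-mixed torsion, then $R_\nabla(Y_a,Y'_a)Y_{a'}=0$ on $U$ for $\{a,a'\}=\{1,2\}$ and all smooth vector fields $Y_a,Y'_a$ on $U$ with values in $\mathcal V_a$ and $Y_{a'}$ on $U$ with values in $\mathcal V_{a'}$. -/

import Mathlib

open Bundle
open scoped Manifold ContDiff

noncomputable section

/-! ### Vector fields, subbundles and linear connections on a smooth manifold -/

namespace SmoothGeometry

variable {E : Type*} [NormedAddCommGroup E] [NormedSpace ℝ E]
  {H : Type*} [TopologicalSpace H] {J : ModelWithCorners ℝ E H}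
  {N : Type*} [TopologicalSpace N] [ChartedSpace H N] [IsManifold J ∞ N]

/-- `X` is a `C^∞` vector field on the set `U` (which will be open). Values outside `U` are
irrelevant. -/
def IsSmoothFieldOn (X : Π q : N, TangentSpace J q) (U : Set N) : Prop :=
  ContMDiffOn J J.tangent ∞ (fun q => (⟨q, X q⟩ : TangentBundle J N)) U

/-- `X` is a `C^∞` section over `U` of the distribution `D`. -/
def IsSectionOn (D : Π q : N, Submodule ℝ (TangentSpace J q))
    (X : Π q : N, TangentSpace J q) (U : Set N) : Prop :=
  IsSmoothFieldOn X U ∧ ∀ q ∈ U, X q ∈ D q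

/-- `D` is a smooth vector subbundle of the tangent bundle: near every point it has a frame of
`C^∞` vector fields. -/
def IsSmoothSubbundle (D : Π q : N, Submodule ℝ (TangentSpace J q)) : Prop :=
  ∀ p : N, ∃ (U : Set N) (k : ℕ) (s : Fin k → Π q : N, TangentSpace J q),
    IsOpen U ∧ p ∈ U ∧ (∀ i, IsSmoothFieldOn (s i) U) ∧
    ∀ q ∈ U, LinearIndependent ℝ (fun i => s i q) ∧
      Submodule.span ℝ (Set.range fun i => s i q) = D q

/-- The connection `∇` is `C^∞`: it maps `C^∞` vector fields on open sets to `C^∞` sections of the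
endomorphism bundle on the same open sets. -/
def IsSmoothConnection (cov : CovariantDerivative J E (TangentSpace J : N → Type _)) : Prop :=
  ∀ U : Set N, IsOpen U → ContMDiffCovariantDerivativeOn E ∞ cov.toFun U

/-- The vector field `∇_X Z`. -/
def nabla (cov : CovariantDerivative J E (TangentSpace J : N → Type _))
    (X Z : Π q : N, TangentSpace J q) : Π q : N, TangentSpace J q :=
  fun q => cov Z q (X q)

/-- The curvature `R(X, Y) Z = ∇_X ∇_Y Z - ∇_Y ∇_X Z - ∇_{[X, Y]} Z`. -/
def curvature (cov : CovariantDerivative J E (TangentSpace J : N → Type _))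
    (X Y Z : Π q : N, TangentSpace J q) : Π q : N, TangentSpace J q :=
  nabla cov X (nabla cov Y Z) - nabla cov Y (nabla cov X Z)
    - nabla cov (VectorField.mlieBracket J X Y) Z

/-- `∇` preserves the distribution `D`: if `Z` is a local section of `D`, then so is `∇_v Z` for
every tangent vector `v`. -/
def Preserves (cov : CovariantDerivative J E (TangentSpace J : N → Type _))
    (D : Π q : N, Submodule ℝ (TangentSpace J q)) : Prop :=
  ∀ (U : Set N), IsOpen U → ∀ Z : Π q : N, TangentSpace J q, IsSectionOn D Z U →
    ∀ q ∈ U, ∀ v : TangentSpace J q, cov Z q v ∈ D q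

end SmoothGeometry

/-! ### The big-tangent manifold -/

namespace BigTangent

open SmoothGeometry

variable (m : ℕ) (M : Type*) [TopologicalSpace M] [ChartedSpace (EuclideanSpace ℝ (Fin m)) M]

/-- The cotangent space at a point. -/
abbrev CotSpace (x : M) : Type :=
  TangentSpace (𝓡 m) x →L[ℝ] Bundle.Trivial M ℝ x

/-- The model fibre of the cotangent bundle. -/
abbrev CotModel : Type := EuclideanSpace ℝ (Fin m) →L[ℝ] ℝ

/-- The model fibre of the big tangent bundle `TM ⊕ T*M`. -/
abbrev FibreModel : Type := EuclideanSpace ℝ (Fin m) × CotModel m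

/-- The model vector space of the big-tangent manifold. -/
abbrev Model : Type := EuclideanSpace ℝ (Fin m) × FibreModel m

/-- The model with corners (without boundary) of the big-tangent manifold. -/
abbrev J : ModelWithCorners ℝ (Model m) (ModelProd (EuclideanSpace ℝ (Fin m)) (FibreModel m)) :=
  (𝓡 m).prod 𝓘(ℝ, FibreModel m)

variable [IsManifold (𝓡 m) ∞ M]

/-- The total space of the cotangent bundle `T*M`. -/
abbrev Cotangent : Type _ := TotalSpace (CotModel m) (CotSpace m M)

/-- The big-tangent manifold: the total space of `TM ⊕ T*M`. Its points are the triples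
`(x, y, z)` with `x ∈ M`, `y ∈ T_x M`, `z ∈ T*_x M`. -/
abbrev Big : Type _ :=
  TotalSpace (FibreModel m) (fun x : M => TangentSpace (𝓡 m) x × CotSpace m M x)

variable {m M}

/-- The projection `(x, y, z) ↦ x`. -/
def proj (q : Big m M) : M := q.proj

/-- The projection `(x, y, z) ↦ (x, y)` onto `TM`. -/
def proj₁ (q : Big m M) : TangentBundle (𝓡 m) M := ⟨q.proj, q.snd.1⟩

/-- The projection `(x, y, z) ↦ (x, z)` onto `T*M`. -/
def proj₂ (q : Big m M) : Cotangent m M := ⟨q.proj, q.snd.2⟩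

/-- The vertical bundle `𝓥`, tangent to the fibres of `TM ⊕ T*M → M`. -/
def vertical (q : Big m M) : Submodule ℝ (TangentSpace (J m) q) :=
  LinearMap.ker (mfderiv (J m) (𝓡 m) (proj (m := m) (M := M)) q).toLinearMap

/-- The bundle `𝓥₁` (locally spanned by the `∂/∂yⁱ`), tangent to the fibres of the projection
onto `T*M`. -/
def vertical₁ (q : Big m M) : Submodule ℝ (TangentSpace (J m) q) :=
  LinearMap.ker
    (mfderiv (J m) ((𝓡 m).prod 𝓘(ℝ, CotModel m)) (proj₂ (m := m) (M := M)) q).toLinearMap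

/-- The bundle `𝓥₂` (locally spanned by the `∂/∂zᵢ`), tangent to the fibres of the projection
onto `TM`. -/
def vertical₂ (q : Big m M) : Submodule ℝ (TangentSpace (J m) q) :=
  LinearMap.ker (mfderiv (J m) (𝓡 m).tangent (proj₁ (m := m) (M := M)) q).toLinearMap

variable (m M) in
/-- A horizontal bundle: a smooth subbundle `𝓗` of the tangent bundle of the big-tangent manifold
that is complementary to the vertical bundle. -/
structure HorizontalBundle where
  /-- The horizontal subspace at a point. -/
  space : Π q : Big m M, Submodule ℝ (TangentSpace (J m) q)
  smooth : IsSmoothSubbundle space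
  isCompl : ∀ q, IsCompl (space q) (vertical q)

namespace HorizontalBundle

variable (𝓗 : HorizontalBundle m M)

/-- The projection onto `𝓗` along `𝓥`, applied to a vector field. -/
def prH (X : Π q : Big m M, TangentSpace (J m) q) : Π q : Big m M, TangentSpace (J m) q :=
  fun q => Submodule.projection _ _ (𝓗.isCompl q) (X q)

/-- The projection onto `𝓥` along `𝓗`, applied to a vector field. -/
def prV (X : Π q : Big m M, TangentSpace (J m) q) : Π q : Big m M, TangentSpace (J m) q :=
  fun q => Submodule.projection _ _ (𝓗.isCompl q).symm (X q)

/-- The Ehresmann curvature `R_𝓗(X, X') = pr_𝓥 [pr_𝓗 X, pr_𝓗 X']`. -/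
def ehresmannCurvature (X X' : Π q : Big m M, TangentSpace (J m) q) :
    Π q : Big m M, TangentSpace (J m) q :=
  𝓗.prV (VectorField.mlieBracket (J m) (𝓗.prH X) (𝓗.prH X'))

end HorizontalBundle

/-- The vector field `X` on `U` is projectable to `M`: there is a field `Z` on `M` such that
`X` and `Z` are related by the projection over `U`. -/
def IsProjectableOn (X : Π q : Big m M, TangentSpace (J m) q) (U : Set (Big m M)) : Prop :=
  ∃ Z : Π x : M, TangentSpace (𝓡 m) x,
    ∀ q ∈ U, mfderiv (J m) (𝓡 m) (proj (m := m) (M := M)) q (X q) = Z (proj q)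

/-- The linear connections on the big-tangent manifold. -/
abbrev Connection (m : ℕ) (M : Type*) [TopologicalSpace M]
    [ChartedSpace (EuclideanSpace ℝ (Fin m)) M] [IsManifold (𝓡 m) ∞ M] : Type _ :=
  CovariantDerivative (J m) (Model m) (TangentSpace (J m) : Big m M → Type _)

/-- Bott connections (connections with no mixed torsion) with respect to `𝓗`. -/
structure IsBott (𝓗 : HorizontalBundle m M) (cov : Connection m M) : Prop where
  preserves_horizontal : Preserves cov 𝓗.space
  preserves_vertical : Preserves cov vertical
  torsion_eq_zero : ∀ (q : Big m M), ∀ u ∈ 𝓗.space q, ∀ v ∈ vertical q, cov.torsion q u v = 0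

/-- Connections with no multi-mixed torsion with respect to `𝓗`. -/
structure IsMultiBott (𝓗 : HorizontalBundle m M) (cov : Connection m M) : Prop
    extends IsBott 𝓗 cov where
  preserves_vertical₁ : Preserves cov vertical₁
  preserves_vertical₂ : Preserves cov vertical₂
  torsion_eq_zero₁₂ : ∀ (q : Big m M), ∀ u ∈ vertical₁ q, ∀ v ∈ vertical₂ q,
    cov.torsion q u v = 0
  torsion_eq_zero₂₁ : ∀ (q : Big m M), ∀ u ∈ vertical₂ q, ∀ v ∈ vertical₁ q,
    cov.torsion q u v = 0

end BigTangent

end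

/-! All four identities come from one situation: two pointwise disjoint distributions `D`, `D'`,
both preserved by `∇`, with no torsion on mixed arguments. For `Y` in `D` and `X` in `D'` this gives
`[Y, X] = ∇_Y X - ∇_X Y`, with the first term in `D'` and the second in `D`. So `∇_Y X` is `[Y, X]`
modulo `D`, and curvature can be compared with Jacobi's identity.

If `D` is involutive, `R(Y, Y')W` lies in `D'`, while modulo `D` it is the Jacobi expression `[Y,
[Y', W]] - [Y', [Y, W]] - [[Y, Y'], W] = 0`; hence it vanishes
(`curvature_eq_zero_of_isInvolutive`). The pair `𝓥, 𝓗` gives (i), and the pairs `𝓥₁, 𝓥₂` and `𝓥₂,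
𝓥₁` give (iv).

If `X` is projectable, `[X, Y]` is vertical for vertical `Y`, so `∇_Y X = 0` and `∇_X Y = [X, Y]`.
In (ii) only `∇_Y ∇_X X'` survives (`curvature_eq_nabla_of_normalizes`). In (iii) the second
derivatives of `Y` are iterated brackets, and Jacobi's identity leaves `[R, Y] - ∇_R Y` with `R =
R_𝓗(X, X')`, which is the torsion expression (`curvature_eq_torsion_sub_nabla`).

The geometric input is that the vertical bundles are kernels of differentials, handled through the
commutator formula `mvfderiv_mlieBracket`, and that the projections onto `𝓗` and `𝓥` preserve
smoothness. -/

section Lemmas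

open VectorField Topology

namespace SmoothGeometry

/-! ### Derivatives of vector-valued functions along fields and brackets -/

section Calculus

variable {E : Type*} [NormedAddCommGroup E] [NormedSpace ℝ E]
  {H : Type*} [TopologicalSpace H] {J : ModelWithCorners ℝ E H}
  {N : Type*} [TopologicalSpace N] [ChartedSpace H N]
  {F : Type*} [NormedAddCommGroup F] [NormedSpace ℝ F]

theorem isManifold_infty_add_one [IsManifold J ∞ N] : IsManifold J (∞ + 1) N := by
  simpa using ‹IsManifold J ∞ N›

theorem isManifold_minSmoothness_three [IsManifold J ∞ N] :
    IsManifold J (minSmoothness ℝ 3) N := by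
  rw [minSmoothness_of_isRCLikeNormedField]; infer_instance

theorem mlieBracket_eq_lieBracket {V W : Π x : E, TangentSpace 𝓘(ℝ, E) x} :
    mlieBracket 𝓘(ℝ, E) V W = lieBracket ℝ V W := by
  rw [← mlieBracketWithin_univ, mlieBracketWithin_eq_lieBracketWithin]
  exact lieBracketWithin_univ

theorem minSmoothness_two_le_infty : minSmoothness ℝ 2 ≤ ∞ := by
  rw [minSmoothness_of_isRCLikeNormedField]
  exact ENat.LEInfty.out

/-- The derivative of a smooth vector-valued function along a smooth vector field is smooth. -/
theorem contMDiffAt_mvfderiv_apply [IsManifold J ∞ N] {ψ : N → F}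
    {X : Π q : N, TangentSpace J q} {q : N} (hψ : ContMDiffAt J 𝓘(ℝ, F) ∞ ψ q)
    (hX : ContMDiffAt J J.tangent ∞ (fun q => (⟨q, X q⟩ : TangentBundle J N)) q) :
    ContMDiffAt J 𝓘(ℝ, F) ∞ (fun q => mvfderiv J ψ q (X q)) q := by
  have h : ContMDiffAt J 𝓘(ℝ, F).tangent ∞
      (fun q => (⟨ψ q, mfderiv J 𝓘(ℝ, F) ψ q (X q)⟩ : TangentBundle 𝓘(ℝ, F) F)) q :=
    ContMDiffAt.clm_apply_of_inCoordinates (b₁ := id) (b₂ := ψ)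
      (hψ.mfderiv_const (m := ∞) (by simp)) hX hψ
  exact (contMDiff_snd_tangentBundle_modelSpace F 𝓘(ℝ, F)).contMDiffAt.comp q h

/-- Chain rule, in the form that yields `𝓥₁ ∩ 𝓥₂ = 0`: there `G` assembles a chart from the
coordinates of the two projections. -/
theorem mvfderiv_comp_prodMk_eq_zero {F₁ F₂ : Type*} [NormedAddCommGroup F₁] [NormedSpace ℝ F₁]
    [NormedAddCommGroup F₂] [NormedSpace ℝ F₂] {G : F₁ × F₂ → F} (hG : Differentiable ℝ G)
    {f : N → F₁} {g : N → F₂} {q : N} (hf : MDifferentiableAt J 𝓘(ℝ, F₁) f q)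
    (hg : MDifferentiableAt J 𝓘(ℝ, F₂) g q) {v : TangentSpace J q}
    (hfv : mvfderiv J f q v = 0) (hgv : mvfderiv J g q v = 0) :
    mvfderiv J (G ∘ fun q => (f q, g q)) q v = 0 := by
  have hd : HasMFDerivAt J 𝓘(ℝ, F₁ × F₂) (fun q => (f q, g q)) q
      (ContinuousLinearMap.prod (mvfderiv J f q) (mvfderiv J g q)) :=
    ⟨hf.hasMFDerivAt.1.prodMk hg.hasMFDerivAt.1, hf.hasMFDerivAt.2.prodMk hg.hasMFDerivAt.2⟩
  have h0 : mfderiv J 𝓘(ℝ, F₁ × F₂) (fun q => (f q, g q)) q v = 0 := by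
    rw [hd.mfderiv]
    exact Prod.ext hfv hgv
  refine (mfderiv_comp_apply q hG.differentiableAt.mdifferentiableAt
    hd.mdifferentiableAt v).trans ?_
  exact (congrArg (mfderiv 𝓘(ℝ, F₁ × F₂) 𝓘(ℝ, F) G _) h0).trans (map_zero _)

/-- Differentiation along `[X, Y]` is the commutator of the differentiations along `X` and `Y`. -/
theorem mvfderiv_mlieBracket [J.Boundaryless] [CompleteSpace E] [IsManifold J ∞ N] {ψ : N → F}
    {X Y : Π q : N, TangentSpace J q} {q : N} (hψ : ContMDiffAt J 𝓘(ℝ, F) ∞ ψ q)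
    (hX : ContMDiffAt J J.tangent ∞ (fun q => (⟨q, X q⟩ : TangentBundle J N)) q)
    (hY : ContMDiffAt J J.tangent ∞ (fun q => (⟨q, Y q⟩ : TangentBundle J N)) q) :
    mvfderiv J ψ q (mlieBracket J X Y q) =
      mvfderiv J (fun q => mvfderiv J ψ q (Y q)) q (X q)
        - mvfderiv J (fun q => mvfderiv J ψ q (X q)) q (Y q) := by
  -- Everything is pulled back along the inverse chart `χ` to the model space, where the formula is
  -- the symmetry of the second derivative.
  set χ := (extChartAt J q).symm
  set u := extChartAt J q q
  have hχu : χ u = q := extChartAt_to_inv q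
  have hχs : ∀ᶠ v in 𝓝 u, ContMDiffAt 𝓘(ℝ, E) J ∞ χ v := by
    filter_upwards [(isOpen_extChartAt_target q).mem_nhds (mem_extChartAt_target q)] with v hv
    exact (contMDiffOn_extChartAt_symm q).contMDiffAt ((isOpen_extChartAt_target q).mem_nhds hv)
  have hinv : ∀ᶠ v in 𝓝 u, (mfderiv 𝓘(ℝ, E) J χ v).IsInvertible := by
    filter_upwards [(isOpen_extChartAt_target q).mem_nhds (mem_extChartAt_target q)] with v hv
    have := isInvertible_mfderivWithin_extChartAt_symm (I := J) hv
    rwa [J.range_eq_univ, mfderivWithin_univ] at this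
  -- the pulled back fields
  have key : ∀ Z : Π q : N, TangentSpace J q,
      ContMDiffAt J J.tangent ∞ (fun q => (⟨q, Z q⟩ : TangentBundle J N)) q →
      DifferentiableAt ℝ (fun v => mpullback 𝓘(ℝ, E) J χ Z v : E → E) u := by
    intro Z hZ
    have : ContMDiffAt 𝓘(ℝ, E) 𝓘(ℝ, E).tangent ∞
        (fun v => (⟨v, mpullback 𝓘(ℝ, E) J χ Z v⟩ : TangentBundle 𝓘(ℝ, E) E)) u :=
      ContMDiffAt.mpullback_vectorField_preimage (n := ∞) (by rwa [hχu]) hχs.self_of_nhds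
        hinv.self_of_nhds (by simp)
    rw [contMDiffAt_vectorSpace_iff_contDiffAt] at this
    exact this.differentiableAt (by simp)
  have hf : ContDiffAt ℝ ∞ (ψ ∘ χ) u :=
    (ContMDiffAt.comp u (by rwa [hχu]) hχs.self_of_nhds).contDiffAt
  have hψe : ∀ᶠ v in 𝓝 u, MDifferentiableAt J 𝓘(ℝ, F) ψ (χ v) := by
    have h1 : ∀ᶠ q' in 𝓝 q, ContMDiffAt J 𝓘(ℝ, F) 1 ψ q' :=
      ((contMDiffAt_iff_contMDiffAt_nhds (by simp)).1 (hψ.of_le (by simp)))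
    have h2 := hχs.self_of_nhds.continuousAt
    rw [ContinuousAt, hχu] at h2
    filter_upwards [h2.eventually h1] with v hv using hv.mdifferentiableAt (by simp)
  -- The pullback of `Z` contains the inverse of `dχ`, which cancels the `dχ` produced by the chain
  -- rule.
  have hpull : ∀ Z : Π q : N, TangentSpace J q,
      (fun v => fderiv ℝ (ψ ∘ χ) v (mpullback 𝓘(ℝ, E) J χ Z v))
        =ᶠ[𝓝 u] (fun q => mvfderiv J ψ q (Z q)) ∘ χ := by
    intro Z
    filter_upwards [hinv, hψe, hχs] with v h1 h2 h3
    rw [← mfderiv_eq_fderiv, mfderiv_comp v h2 (h3.mdifferentiableAt (by simp))]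
    simp only [mpullback_apply]
    change mfderiv J 𝓘(ℝ, F) ψ (χ v) (mfderiv 𝓘(ℝ, E) J χ v _) = _
    rw [h1.self_apply_inverse]
    rfl
  have hd : ∀ Z W : Π q : N, TangentSpace J q,
      ContMDiffAt J J.tangent ∞ (fun q => (⟨q, Z q⟩ : TangentBundle J N)) q →
      fderiv ℝ (fun v => fderiv ℝ (ψ ∘ χ) v (mpullback 𝓘(ℝ, E) J χ Z v)) u
        (mpullback 𝓘(ℝ, E) J χ W u) = mvfderiv J (fun q => mvfderiv J ψ q (Z q)) q (W q) := by
    intro Z W hZ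
    have hg := (contMDiffAt_mvfderiv_apply hψ hZ).mdifferentiableAt (by simp)
    rw [(hpull Z).fderiv_eq, ← mfderiv_eq_fderiv, mfderiv_comp u (by rwa [hχu])
      (hχs.self_of_nhds.mdifferentiableAt (by simp))]
    simp only [mpullback_apply]
    change mfderiv J 𝓘(ℝ, F) _ (χ u) (mfderiv 𝓘(ℝ, E) J χ u _) = _
    rw [hinv.self_of_nhds.self_apply_inverse]
    exact congrArg (fun q => mvfderiv J (fun q => mvfderiv J ψ q (Z q)) q (W q)) hχu
  have := isManifold_minSmoothness_three (J := J) (N := N)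
  have hbr : mpullback 𝓘(ℝ, E) J χ (mlieBracket J X Y) u =
      lieBracket ℝ (fun v => mpullback 𝓘(ℝ, E) J χ X v) (fun v => mpullback 𝓘(ℝ, E) J χ Y v) u := by
    refine (mpullback_mlieBracket (n := ∞) ?_ ?_ hχs.self_of_nhds minSmoothness_two_le_infty).trans
      (congrFun mlieBracket_eq_lieBracket u)
    · rw [hχu]; exact hX.mdifferentiableAt (by simp)
    · rw [hχu]; exact hY.mdifferentiableAt (by simp)
  have hfin := fderiv_apply_lieBracket hf minSmoothness_two_le_infty (key Y hY) (key X hX)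
  calc mvfderiv J ψ q (mlieBracket J X Y q)
      = fderiv ℝ (ψ ∘ χ) u (mpullback 𝓘(ℝ, E) J χ (mlieBracket J X Y) u) :=
        (congrArg (fun q => mvfderiv J ψ q (mlieBracket J X Y q)) hχu).symm.trans
          (hpull (mlieBracket J X Y)).self_of_nhds.symm
    _ = _ := (congrArg (fderiv ℝ (ψ ∘ χ) u) hbr).trans
        (hfin.trans (congrArg₂ (· - ·) (hd Y X hY) (hd X Y hX)))

end Calculus

/-! ### Smooth fields on open sets and the locality of brackets and connections -/

section Fields

variable {E : Type*} [NormedAddCommGroup E] [NormedSpace ℝ E]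
  {H : Type*} [TopologicalSpace H] {J : ModelWithCorners ℝ E H}
  {N : Type*} [TopologicalSpace N] [ChartedSpace H N] [IsManifold J ∞ N]
  {X Y Z : Π q : N, TangentSpace J q} {U : Set N} {q : N}

theorem IsSmoothFieldOn.contMDiffAt (hX : IsSmoothFieldOn X U) (hU : IsOpen U) (hq : q ∈ U) :
    ContMDiffAt J J.tangent ∞ (fun q => (⟨q, X q⟩ : TangentBundle J N)) q :=
  ContMDiffOn.contMDiffAt hX (hU.mem_nhds hq)

theorem IsSmoothFieldOn.mdifferentiableAt (hX : IsSmoothFieldOn X U) (hU : IsOpen U)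
    (hq : q ∈ U) :
    MDifferentiableAt J J.tangent (fun q => (⟨q, X q⟩ : TangentBundle J N)) q :=
  (hX.contMDiffAt hU hq).mdifferentiableAt (by simp)

theorem IsSmoothFieldOn.congr (hX : IsSmoothFieldOn X U) (h : ∀ q ∈ U, Y q = X q) :
    IsSmoothFieldOn Y U :=
  ContMDiffOn.congr hX fun q hq => by rw [h q hq]

theorem IsSmoothFieldOn.sub (hX : IsSmoothFieldOn X U) (hY : IsSmoothFieldOn Y U) :
    IsSmoothFieldOn (X - Y) U :=
  ContMDiffOn.sub_section hX hY

theorem isSmoothFieldOn_zero : IsSmoothFieldOn (0 : Π q : N, TangentSpace J q) U :=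
  (contMDiff_zeroSection ℝ (TangentSpace J : N → Type _)).contMDiffOn

omit [IsManifold J ∞ N] in
theorem eventuallyEq_of_eqOn_isOpen (hU : IsOpen U) (hq : q ∈ U) (h : ∀ q ∈ U, X q = Y q) :
    X =ᶠ[𝓝 q] Y :=
  Filter.eventually_of_mem (hU.mem_nhds hq) h

omit [IsManifold J ∞ N] in
theorem mlieBracket_congr_of_isOpen {X' Y' : Π q : N, TangentSpace J q} (hU : IsOpen U)
    (hq : q ∈ U) (hX : ∀ q ∈ U, X q = X' q) (hY : ∀ q ∈ U, Y q = Y' q) :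
    mlieBracket J X Y q = mlieBracket J X' Y' q :=
  (eventuallyEq_of_eqOn_isOpen hU hq hX).mlieBracket_vectorField_eq
    (eventuallyEq_of_eqOn_isOpen hU hq hY)

section Complete

variable [CompleteSpace E]

theorem IsSmoothFieldOn.mlieBracket (hU : IsOpen U) (hX : IsSmoothFieldOn X U)
    (hY : IsSmoothFieldOn Y U) : IsSmoothFieldOn (mlieBracket J X Y) U := by
  have : IsManifold J (((⊤ : ℕ∞) : WithTop ℕ∞) + 1) N := isManifold_infty_add_one
  have : IsManifold J (minSmoothness ℝ 3) N := isManifold_minSmoothness_three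
  refine fun q hq => ContMDiffAt.contMDiffWithinAt ?_
  refine ContMDiffAt.mlieBracket_vectorField (m := ⊤) (n := ⊤) (hX.contMDiffAt hU hq)
    (hY.contMDiffAt hU hq) ?_
  rw [minSmoothness_of_isRCLikeNormedField]
  simp

theorem IsSmoothFieldOn.jacobi (hU : IsOpen U) (hX : IsSmoothFieldOn X U)
    (hY : IsSmoothFieldOn Y U) (hZ : IsSmoothFieldOn Z U) (hq : q ∈ U) :
    VectorField.mlieBracket J X (VectorField.mlieBracket J Y Z) q =
      VectorField.mlieBracket J (VectorField.mlieBracket J X Y) Z q +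
        VectorField.mlieBracket J Y (VectorField.mlieBracket J X Z) q := by
  have : IsManifold J (minSmoothness ℝ 3) N := isManifold_minSmoothness_three
  exact leibniz_identity_mlieBracket_apply
    ((hX.contMDiffAt hU hq).of_le minSmoothness_two_le_infty)
    ((hY.contMDiffAt hU hq).of_le minSmoothness_two_le_infty)
    ((hZ.contMDiffAt hU hq).of_le minSmoothness_two_le_infty)

theorem mlieBracket_sub_right (hU : IsOpen U) (hq : q ∈ U) (hY : IsSmoothFieldOn Y U)
    (hZ : IsSmoothFieldOn Z U) :
    mlieBracket J X (Y - Z) q = mlieBracket J X Y q - mlieBracket J X Z q := by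
  rw [eq_sub_iff_add_eq, ← mlieBracket_add_right ((hY.sub hZ).mdifferentiableAt hU hq)
    (hZ.mdifferentiableAt hU hq), sub_add_cancel]

end Complete

variable {cov : CovariantDerivative J E (TangentSpace J : N → Type _)}

theorem IsSmoothConnection.isSmoothFieldOn_nabla (hcov : IsSmoothConnection cov) (hU : IsOpen U)
    (hX : IsSmoothFieldOn X U) (hZ : IsSmoothFieldOn Z U) : IsSmoothFieldOn (nabla cov X Z) U := by
  have h := (hcov U hU).contMDiff (σ := Z) (by rw [show (∞ : ℕ∞ω) + 1 = ∞ by simp]; exact hZ)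
  exact ContMDiffOn.clm_bundle_apply h hX

/-- Fields are total functions controlled only on `U`; since a connection depends on germs,
identities on the open set `U` may be differentiated. -/
theorem cov_congr (hU : IsOpen U) (hq : q ∈ U) (hX : IsSmoothFieldOn X U)
    (h : ∀ q ∈ U, X q = Y q) : cov X q = cov Y q :=
  cov.isCovariantDerivativeOnUniv.congr_of_eventuallyEq (hX.mdifferentiableAt hU hq)
    ((hX.congr fun q hq => (h q hq).symm).mdifferentiableAt hU hq) Filter.univ_mem
    (eventuallyEq_of_eqOn_isOpen hU hq h)

theorem cov_eq_zero (hU : IsOpen U) (hq : q ∈ U) (h : ∀ q ∈ U, X q = 0) : cov X q = 0 := by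
  have := cov_congr (cov := cov) (Y := X) hU hq isSmoothFieldOn_zero fun q hq => (h q hq).symm
  rw [← this, cov.zero]
  rfl

theorem IsSmoothConnection.isSectionOn_nabla {D : Π q : N, Submodule ℝ (TangentSpace J q)}
    (hcov : IsSmoothConnection cov) (hD : Preserves cov D) (hU : IsOpen U)
    (hX : IsSmoothFieldOn X U) (hZ : IsSectionOn D Z U) : IsSectionOn D (nabla cov X Z) U :=
  ⟨hcov.isSmoothFieldOn_nabla hU hX hZ.1, fun q hq => hD U hU Z hZ q hq _⟩

/-- The distribution `D` is involutive: brackets of local sections are local sections. -/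
def IsInvolutive (D : Π q : N, Submodule ℝ (TangentSpace J q)) : Prop :=
  ∀ (U : Set N), IsOpen U → ∀ X Y : Π q : N, TangentSpace J q, IsSectionOn D X U →
    IsSectionOn D Y U → ∀ q ∈ U, mlieBracket J X Y q ∈ D q

/-! ### Curvature of connections without mixed torsion -/

section Mixed

variable [CompleteSpace E] {D D' : Π q : N, Submodule ℝ (TangentSpace J q)}

theorem IsInvolutive.isSectionOn (hD : IsInvolutive D) (hU : IsOpen U) (hX : IsSectionOn D X U)
    (hY : IsSectionOn D Y U) : IsSectionOn D (mlieBracket J X Y) U :=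
  ⟨hX.1.mlieBracket hU hY.1, hD U hU X Y hX hY⟩

variable [FiniteDimensional ℝ E]

/-- If `∇` has no mixed torsion for `D, D'`, the bracket of sections of `D` and `D'` is the
commutator of the covariant derivatives. -/
theorem mlieBracket_eq_of_torsion_eq_zero
    (htor : ∀ q, ∀ u ∈ D q, ∀ v ∈ D' q, cov.torsion q u v = 0) (hU : IsOpen U)
    (hY : IsSectionOn D Y U) (hX : IsSectionOn D' X U) (hq : q ∈ U) :
    mlieBracket J Y X q = nabla cov Y X q - nabla cov X Y q := by
  have h := cov.torsion_apply (hY.1.mdifferentiableAt hU hq) (hX.1.mdifferentiableAt hU hq)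
  rw [htor q _ (hY.2 q hq) _ (hX.2 q hq)] at h
  exact (sub_eq_zero.1 h.symm).symm

/-- A component of the bracket of sections of complementary distributions gives the covariant
derivative. -/
theorem nabla_eq_zero_of_mlieBracket_mem (hD : Preserves cov D) (hD' : Preserves cov D')
    (hdisj : ∀ q, Disjoint (D q) (D' q))
    (htor : ∀ q, ∀ u ∈ D q, ∀ v ∈ D' q, cov.torsion q u v = 0) (hU : IsOpen U)
    (hY : IsSectionOn D Y U) (hX : IsSectionOn D' X U) (hq : q ∈ U)
    (h : mlieBracket J Y X q ∈ D q) : nabla cov Y X q = 0 := by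
  rw [mlieBracket_eq_of_torsion_eq_zero htor hU hY hX hq] at h
  refine Submodule.disjoint_def.1 (hdisj q) _ ?_ (hD' U hU X hX q hq _)
  have h' : nabla cov Y X q - nabla cov X Y q + nabla cov X Y q ∈ D q :=
    (D q).add_mem h (hD U hU Y hY q hq (X q))
  rwa [sub_add_cancel] at h'

/-- The `D'`-part `∇_Y X` of `[Y, X]` vanishes, so only `-∇_X Y` is left. -/
theorem nabla_eq_mlieBracket_of_mem (hD : Preserves cov D) (hD' : Preserves cov D')
    (hdisj : ∀ q, Disjoint (D q) (D' q))
    (htor : ∀ q, ∀ u ∈ D q, ∀ v ∈ D' q, cov.torsion q u v = 0) (hU : IsOpen U)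
    (hY : IsSectionOn D Y U) (hX : IsSectionOn D' X U) (hq : q ∈ U)
    (h : mlieBracket J Y X q ∈ D q) : nabla cov X Y q = mlieBracket J X Y q := by
  have h0 := nabla_eq_zero_of_mlieBracket_mem hD hD' hdisj htor hU hY hX hq h
  rw [mlieBracket_swap_apply, mlieBracket_eq_of_torsion_eq_zero htor hU hY hX hq, h0]
  simp

/-- The curvature lies in `D'` by preservation and in `D` by Jacobi's identity. Disjointness
suffices; `D` and `D'` need not span, which allows `𝓥₁` and `𝓥₂`. -/
theorem curvature_eq_zero_of_isInvolutive (hcov : IsSmoothConnection cov)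
    (hD : Preserves cov D) (hD' : Preserves cov D')
    (hdisj : ∀ q, Disjoint (D q) (D' q))
    (htor : ∀ q, ∀ u ∈ D q, ∀ v ∈ D' q, cov.torsion q u v = 0) (hinv : IsInvolutive D)
    (hU : IsOpen U) {Y Y' W : Π q : N, TangentSpace J q}
    (hY : IsSectionOn D Y U) (hY' : IsSectionOn D Y' U) (hW : IsSectionOn D' W U) (hq : q ∈ U) :
    curvature cov Y Y' W q = 0 := by
  have hbr := hinv.isSectionOn hU hY hY'
  -- modulo `D`, the iterated covariant derivative is the iterated bracket
  have key : ∀ {A B : Π q : N, TangentSpace J q}, IsSectionOn D A U → IsSectionOn D B U →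
      nabla cov A (nabla cov B W) q - mlieBracket J A (mlieBracket J B W) q ∈ D q := by
    intro A B hA hB
    have hBW := hcov.isSectionOn_nabla hD' hU hB.1 hW
    have hWB := hcov.isSectionOn_nabla hD hU hW.1 hB
    rw [mlieBracket_congr_of_isOpen (X' := A) (Y' := nabla cov B W - nabla cov W B) hU hq
      (fun _ _ => rfl) (fun q hq => mlieBracket_eq_of_torsion_eq_zero htor hU hB hW hq),
      mlieBracket_sub_right hU hq hBW.1 hWB.1,
      mlieBracket_eq_of_torsion_eq_zero htor hU hA hBW hq, sub_sub, sub_sub_cancel]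
    -- The difference is `∇_{∇_B W} A + [A, ∇_W B]`: the first term is in `D` by preservation, the
    -- second by involutivity.
    exact (D q).add_mem (hD U hU A hA q hq _) (hinv U hU _ _ hA hWB q hq)
  refine Submodule.disjoint_def.1 (hdisj q) _ ?_ ?_
  · have h1 := key hY hY'
    have h2 := key hY' hY
    have h3 := mlieBracket_eq_of_torsion_eq_zero htor hU hbr hW hq
    have h4 := hD U hU _ hbr q hq (W q)
    have h5 := hY.1.jacobi hU hY'.1 hW.1 hq
    -- The correction `h4` is `∇_W [Y, Y']`, the difference between `∇_{[Y, Y']} W` and `[[Y, Y'],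
    -- W]`; the iterated brackets cancel by Jacobi's identity.
    convert (D q).sub_mem ((D q).sub_mem h1 h2) h4 using 1
    rw [h5, h3]
    simp only [curvature, nabla, Pi.sub_apply]
    abel
  · exact (D' q).sub_mem ((D' q).sub_mem
      (hD' U hU _ (hcov.isSectionOn_nabla hD' hU hY'.1 hW) q hq _)
      (hD' U hU _ (hcov.isSectionOn_nabla hD' hU hY.1 hW) q hq _)) (hD' U hU _ hW q hq _)

omit [FiniteDimensional ℝ E] [CompleteSpace E] in
theorem nabla_add_left (A B Z : Π q : N, TangentSpace J q) :
    nabla cov (A + B) Z = nabla cov A Z + nabla cov B Z := by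
  funext q
  exact ContinuousLinearMap.map_add (cov Z q) (A q) (B q)

/-- The sections of `D` over `U` are stable under the bracket with `X`. -/
def Normalizes (D : Π q : N, Submodule ℝ (TangentSpace J q)) (U : Set N)
    (X : Π q : N, TangentSpace J q) : Prop :=
  ∀ Y : Π q : N, TangentSpace J q, IsSectionOn D Y U → ∀ q ∈ U, mlieBracket J X Y q ∈ D q

omit [FiniteDimensional ℝ E] in
theorem Normalizes.isSectionOn (hXn : Normalizes D U X) (hU : IsOpen U) (hX : IsSmoothFieldOn X U)
    (hY : IsSectionOn D Y U) : IsSectionOn D (mlieBracket J X Y) U :=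
  ⟨hX.mlieBracket hU hY.1, hXn Y hY⟩

/-- The curvature of a connection without mixed torsion on mixed arguments, the transverse ones
being infinitesimal symmetries of `D`: it is a covariant derivative along `D`. -/
theorem curvature_eq_nabla_of_normalizes (hD : Preserves cov D) (hD' : Preserves cov D')
    (hdisj : ∀ q, Disjoint (D q) (D' q))
    (htor : ∀ q, ∀ u ∈ D q, ∀ v ∈ D' q, cov.torsion q u v = 0)
    (hU : IsOpen U) {X' : Π q : N, TangentSpace J q} (hY : IsSectionOn D Y U)
    (hX : IsSectionOn D' X U) (hX' : IsSectionOn D' X' U) (hXn : Normalizes D U X)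
    (hXn' : Normalizes D U X') (hq : q ∈ U) :
    curvature cov Y X X' q = nabla cov Y (nabla cov X X') q := by
  have hzero : ∀ {Z : Π q : N, TangentSpace J q}, IsSectionOn D Z U → ∀ q ∈ U,
      nabla cov Z X' q = 0 := fun {Z} hZ q hq => by
    refine nabla_eq_zero_of_mlieBracket_mem hD hD' hdisj htor hU hZ hX' hq ?_
    rw [mlieBracket_swap_apply]
    exact (D q).neg_mem (hXn' Z hZ q hq)
  have hYX : IsSectionOn D (mlieBracket J Y X) U := by
    refine ⟨hY.1.mlieBracket hU hX.1, fun q hq => ?_⟩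
    rw [mlieBracket_swap_apply]
    exact (D q).neg_mem (hXn Y hY q hq)
  -- `∇_Y X'` vanishes on all of the open set `U`, not just at `q`, so its derivative vanishes too.
  have h1 : nabla cov X (nabla cov Y X') q = 0 := by
    rw [nabla, cov_eq_zero hU hq (hzero hY)]
    rfl
  rw [curvature, Pi.sub_apply, Pi.sub_apply, h1, hzero hYX q hq, sub_zero, sub_zero]

/-- The curvature of a connection without mixed torsion on two transverse infinitesimal symmetries
of `D` with `[X, X'] = A + R`, where `A` is a section of `D'` and `R` one of `D`. -/
theorem curvature_eq_torsion_sub_nabla (hcov : IsSmoothConnection cov)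
    (hD : Preserves cov D) (hD' : Preserves cov D')
    (hdisj : ∀ q, Disjoint (D q) (D' q))
    (htor : ∀ q, ∀ u ∈ D q, ∀ v ∈ D' q, cov.torsion q u v = 0) (hinv : IsInvolutive D)
    (hU : IsOpen U) {X' A R : Π q : N, TangentSpace J q} (hY : IsSectionOn D Y U)
    (hX : IsSectionOn D' X U) (hX' : IsSectionOn D' X' U) (hXn : Normalizes D U X)
    (hXn' : Normalizes D U X') (hA : IsSectionOn D' A U) (hR : IsSectionOn D R U)
    (hAR : mlieBracket J X X' = A + R) (hq : q ∈ U) :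
    curvature cov X X' Y q = cov.torsion q (Y q) (R q) - nabla cov Y R q := by
  have hcomm : ∀ {B Z : Π q : N, TangentSpace J q}, IsSectionOn D' B U → IsSectionOn D Z U →
      ∀ q ∈ U, mlieBracket J B Z q ∈ D q → nabla cov B Z q = mlieBracket J B Z q := by
    intro B Z hB hZ q hq h
    refine nabla_eq_mlieBracket_of_mem hD hD' hdisj htor hU hZ hB hq ?_
    rw [mlieBracket_swap_apply]
    exact (D q).neg_mem h
  have hit : ∀ {B C : Π q : N, TangentSpace J q}, IsSectionOn D' B U → IsSectionOn D' C U →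
      Normalizes D U B → Normalizes D U C →
      nabla cov B (nabla cov C Y) q = mlieBracket J B (mlieBracket J C Y) q := by
    intro B C hB hC hBn hCn
    have hCY := hCn.isSectionOn hU hC.1 hY
    rw [← hcomm hB hCY q hq (hBn _ hCY q hq), nabla, nabla,
      cov_congr hU hq (hcov.isSmoothFieldOn_nabla hU hC.1 hY.1) fun q hq =>
        hcomm hC hY q hq (hCY.2 q hq)]
  have hjac := hX.1.jacobi hU hX'.1 hY.1 hq
  have hsplit : mlieBracket J (mlieBracket J X X') Y q =
      mlieBracket J A Y q + mlieBracket J R Y q := by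
    rw [hAR, mlieBracket_add_left (hA.1.mdifferentiableAt hU hq) (hR.1.mdifferentiableAt hU hq)]
  -- `A` is not assumed to normalize `D`, but `[A, Y] = [X, [X', Y]] - [X', [X, Y]] - [R, Y]` by
  -- Jacobi's identity, and every term on the right is in `D`.
  have hAY : nabla cov A Y q = mlieBracket J A Y q := by
    refine hcomm hA hY q hq ?_
    rw [eq_sub_of_add_eq hsplit.symm, eq_sub_of_add_eq hjac.symm]
    exact (D q).sub_mem ((D q).sub_mem
      (hXn _ (hXn'.isSectionOn hU hX'.1 hY) q hq)
      (hXn' _ (hXn.isSectionOn hU hX.1 hY) q hq)) (hinv U hU _ _ hR hY q hq)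
  have htorR : cov.torsion q (Y q) (R q) = nabla cov Y R q - nabla cov R Y q
      - mlieBracket J Y R q :=
    cov.torsion_apply (hY.1.mdifferentiableAt hU hq) (hR.1.mdifferentiableAt hU hq)
  -- The terms in `A` cancel. What remains is `[R, Y] - ∇_R Y`, which equals `T(Y, R) - ∇_Y R`.
  rw [curvature, Pi.sub_apply, Pi.sub_apply, hit hX hX' hXn hXn', hit hX' hX hXn' hXn, hjac,
    hsplit, htorR, mlieBracket_swap_apply (V := Y), hAR, nabla_add_left, Pi.add_apply, hAY]
  abel

end Mixed

end Fields

/-! ### Fields tangent to fibres, related fields, and smooth complements -/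

section Submersion

variable {E : Type*} [NormedAddCommGroup E] [NormedSpace ℝ E]
  {H : Type*} [TopologicalSpace H] {J : ModelWithCorners ℝ E H}
  {N : Type*} [TopologicalSpace N] [ChartedSpace H N]
  {E' : Type*} [NormedAddCommGroup E'] [NormedSpace ℝ E']
  {H' : Type*} [TopologicalSpace H'] {J' : ModelWithCorners ℝ E' H'}
  {N' : Type*} [TopologicalSpace N'] [ChartedSpace H' N'] [IsManifold J' ∞ N']
  {f : N → N'} {X Y Z : Π q : N, TangentSpace J q} {U : Set N} {q : N}

omit [IsManifold J' ∞ N'] in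
theorem eventually_mem_chart_source (hf : ContMDiff J J' ∞ f) (q : N) :
    ∀ᶠ q' in 𝓝 q, f q' ∈ (chartAt H' (f q)).source :=
  hf.continuous.continuousAt.eventually
    ((chartAt H' (f q)).open_source.mem_nhds (mem_chart_source H' (f q)))

theorem contMDiffAt_extChartAt_comp (hf : ContMDiff J J' ∞ f) {q' : N}
    (hq' : f q' ∈ (chartAt H' (f q)).source) :
    ContMDiffAt J 𝓘(ℝ, E') ∞ (extChartAt J' (f q) ∘ f) q' :=
  ContMDiffAt.comp q' (contMDiffAt_extChartAt' hq') (hf q')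

theorem mvfderiv_extChartAt_comp (hf : ContMDiff J J' ∞ f) {q' : N}
    (hq' : f q' ∈ (chartAt H' (f q)).source) (v : TangentSpace J q') :
    mvfderiv J (extChartAt J' (f q) ∘ f) q' v =
      mvfderiv J' (extChartAt J' (f q)) (f q') (mfderiv J J' f q' v) :=
  mfderiv_comp_apply q' ((contMDiffAt_extChartAt' (n := ∞) hq').mdifferentiableAt (by simp))
    ((hf q').mdifferentiableAt (by simp)) v

/-- Charts have invertible differentials, so the kernel of `df` is cut out by a vector-valued
function, to which the commutator formula applies. -/
theorem mvfderiv_extChartAt_comp_eq_zero_iff (hf : ContMDiff J J' ∞ f) {q' : N}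
    (hq' : f q' ∈ (chartAt H' (f q)).source) (v : TangentSpace J q') :
    mvfderiv J (extChartAt J' (f q) ∘ f) q' v = 0 ↔ mfderiv J J' f q' v = 0 := by
  rw [mvfderiv_extChartAt_comp hf hq']
  have := (isInvertible_mfderiv_extChartAt (I := J') (x := f q) (y := f q')
    (by rwa [extChartAt_source])).injective
  exact map_eq_zero_iff _ this

variable [IsManifold J ∞ N] [J.Boundaryless] [CompleteSpace E]

/-- The kernel of the differential of a smooth map is involutive. -/
theorem isInvolutive_ker_mfderiv (hf : ContMDiff J J' ∞ f) :
    IsInvolutive (fun q : N => LinearMap.ker (mfderiv J J' f q).toLinearMap) := by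
  intro U hU X Y hX hY q hq
  -- Derivatives along sections of the kernel vanish identically near `q`, which kills both terms of
  -- the commutator formula.
  have hzero : ∀ Z : Π q : N, TangentSpace J q,
      IsSectionOn (fun q : N => LinearMap.ker (mfderiv J J' f q).toLinearMap) Z U →
      (fun q' => mvfderiv J (extChartAt J' (f q) ∘ f) q' (Z q')) =ᶠ[𝓝 q] fun _ => 0 := by
    intro Z hZ
    filter_upwards [hU.mem_nhds hq, eventually_mem_chart_source hf q] with q' h1 h2
    exact (mvfderiv_extChartAt_comp_eq_zero_iff hf h2 _).2 (hZ.2 q' h1)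
  have hd : ∀ Z : Π q : N, TangentSpace J q,
      IsSectionOn (fun q : N => LinearMap.ker (mfderiv J J' f q).toLinearMap) Z U →
      mvfderiv J (fun q' => mvfderiv J (extChartAt J' (f q) ∘ f) q' (Z q')) q = 0 := by
    intro Z hZ
    rw [mvfderiv, (hzero Z hZ).mfderiv_eq, mfderiv_const]
    rfl
  have hs := mem_chart_source H' (f q)
  refine (mvfderiv_extChartAt_comp_eq_zero_iff hf hs _).1 ?_
  rw [mvfderiv_mlieBracket (contMDiffAt_extChartAt_comp hf hs) (hX.1.contMDiffAt hU hq)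
    (hY.1.contMDiffAt hU hq), hd X hX, hd Y hY]
  simp

/-- The bracket of a field that is related to a field on the base of a map `f` with local sections
and of a field tangent to the fibres of `f` is tangent to the fibres of `f`. -/
theorem mlieBracket_mem_ker_mfderiv (hf : ContMDiff J J' ∞ f) (hU : IsOpen U) (hq : q ∈ U)
    {σ : N' → N} (hσ : MDifferentiableAt J' J σ (f q)) (hσq : σ (f q) = q)
    (hσf : ∀ x, f (σ x) = x)
    (hX : IsSmoothFieldOn X U) {W : Π x : N', TangentSpace J' x}
    (hW : ∀ q ∈ U, mfderiv J J' f q (X q) = W (f q))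
    (hY : IsSectionOn (fun q : N => LinearMap.ker (mfderiv J J' f q).toLinearMap) Y U) :
    mlieBracket J X Y q ∈ LinearMap.ker (mfderiv J J' f q).toLinearMap := by
  have hs := mem_chart_source H' (f q)
  set ψ := extChartAt J' (f q) ∘ f
  have hψs : ContMDiffAt J 𝓘(ℝ, E') ∞ ψ q := contMDiffAt_extChartAt_comp hf hs
  refine (mvfderiv_extChartAt_comp_eq_zero_iff hf hs _).1 ?_
  rw [mvfderiv_mlieBracket hψs (hX.contMDiffAt hU hq) (hY.1.contMDiffAt hU hq)]
  have hYz : (fun q' => mvfderiv J ψ q' (Y q')) =ᶠ[𝓝 q] fun _ => 0 := by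
    filter_upwards [hU.mem_nhds hq, eventually_mem_chart_source hf q] with q' h1 h2
    exact (mvfderiv_extChartAt_comp_eq_zero_iff hf h2 _).2 (hY.2 q' h1)
  set G : N → E' := fun q' => mvfderiv J ψ q' (X q') with hG
  have hGd : MDifferentiableAt J 𝓘(ℝ, E') G q :=
    (contMDiffAt_mvfderiv_apply hψs (hX.contMDiffAt hU hq)).mdifferentiableAt (by simp)
  have hGval : ∀ q' ∈ U, f q' ∈ (chartAt H' (f q)).source →
      G q' = mvfderiv J' (extChartAt J' (f q)) (f q') (W (f q')) := by
    intro q' h1 h2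
    rw [hG, ← hW q' h1]
    exact mvfderiv_extChartAt_comp hf h2 _
  have hcont : Filter.Tendsto (fun q' => σ (f q')) (𝓝 q) (𝓝 q) := by
    have := hσ.continuousAt.comp_of_eq hf.continuous.continuousAt rfl
    rwa [ContinuousAt, Function.comp_apply, hσq] at this
  -- `G` is constant along the fibres, but `W` is not assumed smooth. The section `σ` shows that `G`
  -- factors through `f` by a function differentiable at `f q`, so its derivative along the fibres
  -- is zero.
  have hGeq : G =ᶠ[𝓝 q] (G ∘ σ) ∘ f := by
    filter_upwards [hU.mem_nhds hq, hcont.eventually (hU.mem_nhds hq),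
      eventually_mem_chart_source hf q] with q' h1 h2 h3
    rw [hGval q' h1 h3]
    simp only [Function.comp_apply]
    rw [hGval _ h2 (by rwa [hσf]), hσf]
  have hGY : mvfderiv J G q (Y q) = 0 := by
    have hGσ : MDifferentiableAt J' 𝓘(ℝ, E') (G ∘ σ) (f q) :=
      MDifferentiableAt.comp (f q) (by rwa [hσq]) hσ
    rw [mvfderiv, hGeq.mfderiv_eq, mfderiv_comp q hGσ ((hf q).mdifferentiableAt (by simp))]
    have h0 : mfderiv J J' f q (Y q) = 0 := hY.2 q hq
    exact (congrArg (mfderiv J' 𝓘(ℝ, E') (G ∘ σ) (f q)) h0).trans (map_zero _)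
  have hYd : mvfderiv J (fun q' => mvfderiv J ψ q' (Y q')) q = 0 := by
    rw [mvfderiv, hYz.mfderiv_eq, mfderiv_const]
    rfl
  rw [hGY, hYd]
  simp

omit [J.Boundaryless] [CompleteSpace E] in
/-- A smooth field, projected pointwise onto a smooth subbundle on which the differential of a
smooth map is injective, remains smooth. -/
theorem IsSmoothSubbundle.isSmoothFieldOn_of_mfderiv_eq
    [FiniteDimensional ℝ E'] {D : Π q : N, Submodule ℝ (TangentSpace J q)}
    (hD : IsSmoothSubbundle D) (hf : ContMDiff J J' ∞ f)
    (hdisj : ∀ q, Disjoint (D q) (LinearMap.ker (mfderiv J J' f q).toLinearMap)) (hU : IsOpen U)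
    (hX : IsSmoothFieldOn X U) (hY : ∀ q ∈ U, Y q ∈ D q)
    (hXY : ∀ q ∈ U, mfderiv J J' f q (Y q) = mfderiv J J' f q (X q)) : IsSmoothFieldOn Y U := by
  intro p hp
  apply ContMDiffAt.contMDiffWithinAt
  obtain ⟨U₀, k, s, hU₀, hpU₀, hs, hspan⟩ := hD p
  set ψ := extChartAt J' (f p) ∘ f
  have hψs : ContMDiffAt J 𝓘(ℝ, E') ∞ ψ p :=
    contMDiffAt_extChartAt_comp hf (mem_chart_source H' (f p))
  -- the differential of `ψ` on `D`, in terms of the frame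
  let A : N → (Fin k → ℝ) →L[ℝ] E' := fun q =>
    ∑ i, (ContinuousLinearMap.proj (R := ℝ) (φ := fun _ : Fin k => ℝ) i).smulRight
      (mvfderiv J ψ q (s i q))
  have hA : ∀ q c, A q c = mvfderiv J ψ q (∑ i, c i • s i q) := by
    intro q c
    simp [A, map_sum]
  have hinj : LinearMap.ker (A p).toLinearMap = ⊥ := by
    rw [LinearMap.ker_eq_bot']
    intro c hc
    have hc : A p c = 0 := hc
    rw [hA, mvfderiv_extChartAt_comp_eq_zero_iff hf (mem_chart_source H' (f p))] at hc
    have hmem : ∑ i, c i • s i p ∈ D p := by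
      rw [← (hspan p hpU₀).2]
      exact Submodule.sum_mem _ fun i _ =>
        Submodule.smul_mem _ _ (Submodule.subset_span (Set.mem_range_self i))
    have h0 := Submodule.disjoint_def.1 (hdisj p) _ hmem hc
    exact funext (Fintype.linearIndependent_iff.1 (hspan p hpU₀).1 c h0)
  -- `L` is a left inverse of `A` at the single point `p`. Invertibility is an open condition, so `L
  -- ∘L A q` stays invertible for `q` near `p`.
  obtain ⟨L₀, hL₀⟩ := LinearMap.exists_leftInverse_of_injective _ hinj
  let L : E' →L[ℝ] (Fin k → ℝ) := LinearMap.toContinuousLinearMap L₀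
  have hLA : L ∘L A p = ContinuousLinearMap.id ℝ (Fin k → ℝ) := by
    ext1 c
    exact LinearMap.congr_fun hL₀ c
  have hAs : ContMDiffAt J 𝓘(ℝ, (Fin k → ℝ) →L[ℝ] E') ∞ A p := by
    refine contMDiffAt_finsetSum fun i _ => ?_
    exact (ContinuousLinearMap.contMDiff (ContinuousLinearMap.smulRightL ℝ (Fin k → ℝ) E'
      (ContinuousLinearMap.proj (R := ℝ) (φ := fun _ : Fin k => ℝ) i))).contMDiffAt.comp p
      (contMDiffAt_mvfderiv_apply hψs ((hs i).contMDiffAt hU₀ hpU₀))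
  have hBs : ContMDiffAt J 𝓘(ℝ, (Fin k → ℝ) →L[ℝ] (Fin k → ℝ)) ∞ (fun q => L ∘L A q) p :=
    contMDiffAt_const.clm_comp hAs
  have hBinv : ContinuousLinearMap.IsInvertible (L ∘L A p) := by
    rw [hLA]
    exact ⟨.refl ℝ _, rfl⟩
  have hBe : ∀ᶠ q in 𝓝 p, ContinuousLinearMap.IsInvertible (L ∘L A q) := by
    obtain ⟨e, he⟩ := hBinv
    have := hBs.continuousAt
    rw [ContinuousAt, ← he] at this
    exact this.eventually (ContinuousLinearEquiv.nhds e)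
  -- The frame coefficients `c` of `Y` satisfy `A q c = dψ (X q)`. Applying `L` and inverting `L ∘L
  -- A q` solves for them smoothly.
  let d : N → Fin k → ℝ := fun q =>
    ContinuousLinearMap.inverse (L ∘L A q) (L (mvfderiv J ψ q (X q)))
  have hds : ContMDiffAt J 𝓘(ℝ, Fin k → ℝ) ∞ d p := by
    refine ContMDiffAt.clm_apply ?_ (contMDiffAt_const.clm_apply
      (contMDiffAt_mvfderiv_apply hψs (hX.contMDiffAt hU hp)))
    exact (hBinv.contDiffAt_map_inverse (n := ∞)).contMDiffAt.comp p hBs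
  have hYe : ∀ᶠ q in 𝓝 p, Y q = ∑ i, d q i • s i q := by
    filter_upwards [hBe, hU.mem_nhds hp, hU₀.mem_nhds hpU₀, eventually_mem_chart_source hf p]
      with q h1 h2 h3 h4
    have hYq := hY q h2
    rw [← (hspan q h3).2, Submodule.mem_span_range_iff_exists_fun] at hYq
    obtain ⟨c, hc⟩ := hYq
    have hAc : A q c = mvfderiv J ψ q (X q) := by
      rw [hA, hc, mvfderiv_extChartAt_comp hf h4, mvfderiv_extChartAt_comp hf h4, hXY q h2]
    have hcd : d q = c := by
      simp only [d]
      rw [← hAc]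
      exact h1.inverse_apply_self c
    rw [hcd, hc]
  refine (ContMDiffAt.sum_section (t := fun i q => d q i • s i q) (s := Finset.univ)
    fun i _ => ContMDiffAt.smul_section (f := fun q => d q i) (s := s i) ?_
      ((hs i).contMDiffAt hU₀ hpU₀)).congr_of_eventuallyEq ?_
  · exact contMDiffAt_pi_space.1 hds i
  · filter_upwards [hYe] with q h
    rw [h]

end Submersion
end SmoothGeometry

/-! ### The big-tangent manifold: vertical bundles, horizontal projection, Bott connections -/

namespace BigTangent

open SmoothGeometry

variable {m : ℕ} {M : Type*} [TopologicalSpace M] [ChartedSpace (EuclideanSpace ℝ (Fin m)) M]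
  [IsManifold (𝓡 m) ∞ M]

theorem contMDiff_bigProj : ContMDiff (J m) (𝓡 m) ∞ (proj (m := m) (M := M)) :=
  Bundle.contMDiff_proj (fun x : M => TangentSpace (𝓡 m) x × CotSpace m M x)

/-- The fibre coordinates on the big-tangent manifold. -/
theorem contMDiffAt_fibreCoordinates (q : Big m M) :
    ContMDiffAt (J m) 𝓘(ℝ, FibreModel m) ∞
      (fun q' : Big m M => (trivializationAt (FibreModel m)
        (fun x : M => TangentSpace (𝓡 m) x × CotSpace m M x) q.proj q').2) q :=
  (Bundle.contMDiffAt_totalSpace.1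
    (contMDiffAt_id : ContMDiffAt (J m) (J m) ∞ (id : Big m M → Big m M) q)).2

theorem contMDiff_proj₁ : ContMDiff (J m) (𝓡 m).tangent ∞ (proj₁ (m := m) (M := M)) := by
  intro q
  refine Bundle.contMDiffAt_totalSpace.2 ⟨contMDiff_bigProj q, ?_⟩
  exact contDiff_fst.contMDiff.contMDiffAt.comp q (contMDiffAt_fibreCoordinates q)

theorem contMDiff_proj₂ :
    ContMDiff (J m) ((𝓡 m).prod 𝓘(ℝ, CotModel m)) ∞ (proj₂ (m := m) (M := M)) := by
  intro q
  refine Bundle.contMDiffAt_totalSpace.2 ⟨contMDiff_bigProj q, ?_⟩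
  exact (contDiff_snd (E := EuclideanSpace ℝ (Fin m)) (F := CotModel m)).contMDiff.contMDiffAt.comp
    q (contMDiffAt_fibreCoordinates q)

theorem isInvolutive_vertical : IsInvolutive (vertical (m := m) (M := M)) :=
  isInvolutive_ker_mfderiv contMDiff_bigProj

theorem isInvolutive_vertical₁ : IsInvolutive (vertical₁ (m := m) (M := M)) :=
  isInvolutive_ker_mfderiv contMDiff_proj₂

theorem isInvolutive_vertical₂ : IsInvolutive (vertical₂ (m := m) (M := M)) :=
  isInvolutive_ker_mfderiv contMDiff_proj₁

theorem disjoint_vertical₁_vertical₂ (q : Big m M) : Disjoint (vertical₁ q) (vertical₂ q) := by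
  rw [Submodule.disjoint_def]
  intro v h₁ h₂
  -- the chart at `q` factors through `(proj₁, proj₂)`
  let G : (EuclideanSpace ℝ (Fin m) × EuclideanSpace ℝ (Fin m)) ×
      (EuclideanSpace ℝ (Fin m) × CotModel m) → Model m := fun a => (a.1.1, a.1.2, a.2.2)
  have hG : Differentiable ℝ G := by fun_prop
  have hs₁ := mem_chart_source (ModelProd (EuclideanSpace ℝ (Fin m)) (EuclideanSpace ℝ (Fin m)))
    (proj₁ q)
  have hs₂ := mem_chart_source (ModelProd (EuclideanSpace ℝ (Fin m)) (CotModel m)) (proj₂ q)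
  -- The trivialization of `TM ⊕ T*M` is the product of the two trivializations. `G` drops the
  -- second copy of the base coordinates.
  have hfac : (extChartAt (J m) q : Big m M → Model m) = G ∘ fun q' =>
      ((extChartAt (𝓡 m).tangent (proj₁ q) ∘ proj₁) q',
        (extChartAt ((𝓡 m).prod 𝓘(ℝ, CotModel m)) (proj₂ q) ∘ proj₂) q') := rfl
  have d₁ := (contMDiffAt_extChartAt_comp contMDiff_proj₁ hs₁).mdifferentiableAt
    (by simp : (∞ : ℕ∞ω) ≠ 0)
  have d₂ := (contMDiffAt_extChartAt_comp contMDiff_proj₂ hs₂).mdifferentiableAt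
    (by simp : (∞ : ℕ∞ω) ≠ 0)
  have e₁ := (mvfderiv_extChartAt_comp_eq_zero_iff contMDiff_proj₁ hs₁ v).2 h₂
  have e₂ := (mvfderiv_extChartAt_comp_eq_zero_iff contMDiff_proj₂ hs₂ v).2 h₁
  have hinj := (isInvertible_mfderiv_extChartAt (I := J m) (x := q)
    (mem_extChartAt_source q)).injective
  refine (map_eq_zero_iff _ hinj).1 ?_
  rw [hfac]
  exact mvfderiv_comp_prodMk_eq_zero hG d₁ d₂ e₁ e₂

/-- Every point of the big-tangent manifold lies on a local section of the projection. -/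
theorem exists_section (q : Big m M) : ∃ σ : M → Big m M,
    MDifferentiableAt (𝓡 m) (J m) σ (proj q) ∧ σ (proj q) = q ∧ ∀ x, proj (σ x) = x :=
  ⟨fun x => ⟨x, FiberBundle.extend
      (E := fun x : M => TangentSpace (𝓡 m) x × CotSpace m M x) (FibreModel m) q.snd x⟩,
    FiberBundle.mdifferentiableAt_extend
      (V := fun x : M => TangentSpace (𝓡 m) x × CotSpace m M x) (𝓡 m) (FibreModel m) q.snd,
    congrArg (TotalSpace.mk q.proj) (FiberBundle.extend_apply_self
      (E := fun x : M => TangentSpace (𝓡 m) x × CotSpace m M x) (FibreModel m) q.snd),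
    fun _ => rfl⟩

variable {X X' Y Z : Π q : Big m M, TangentSpace (J m) q} {U : Set (Big m M)} {q : Big m M}

theorem IsProjectableOn.mlieBracket_mem_vertical (hU : IsOpen U) (hX : IsSmoothFieldOn X U)
    (hXp : IsProjectableOn X U) (hY : IsSectionOn vertical Y U) (hq : q ∈ U) :
    mlieBracket (J m) X Y q ∈ vertical q := by
  obtain ⟨W, hW⟩ := hXp
  obtain ⟨σ, hσ, hσq, hσf⟩ := exists_section q
  exact mlieBracket_mem_ker_mfderiv contMDiff_bigProj hU hq hσ hσq hσf hX hW hY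

namespace HorizontalBundle

variable (𝓗 : HorizontalBundle m M)

theorem prH_add_prV (q : Big m M) : 𝓗.prH X q + 𝓗.prV X q = X q :=
  Submodule.projection_add_projection_eq_self (𝓗.isCompl q) (X q)

theorem prH_mem (q : Big m M) : 𝓗.prH X q ∈ 𝓗.space q :=
  Submodule.projection_apply_mem (𝓗.isCompl q) (X q)

theorem prV_mem (q : Big m M) : 𝓗.prV X q ∈ vertical q :=
  Submodule.projection_apply_mem (𝓗.isCompl q).symm (X q)

theorem prH_eq_of_sub_mem {v : TangentSpace (J m) q} (hv : v ∈ 𝓗.space q)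
    (h : X q - v ∈ vertical q) : 𝓗.prH X q = v := by
  have h1 : 𝓗.prH X q - v ∈ vertical q := by
    convert (vertical q).sub_mem h (𝓗.prV_mem (X := X) q) using 1
    rw [← 𝓗.prH_add_prV (X := X) q]
    abel
  exact sub_eq_zero.1 (Submodule.disjoint_def.1 (𝓗.isCompl q).disjoint _
    ((𝓗.space q).sub_mem (𝓗.prH_mem q) hv) h1)

theorem prH_eq_self (h : X q ∈ 𝓗.space q) : 𝓗.prH X q = X q :=
  𝓗.prH_eq_of_sub_mem h (by simp)

/-- `X` and its horizontal part have the same image under `dp`, and `dp` is injective on `𝓗`. -/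
theorem isSectionOn_prH (hU : IsOpen U) (hX : IsSmoothFieldOn X U) :
    IsSectionOn 𝓗.space (𝓗.prH X) U := by
  refine ⟨𝓗.smooth.isSmoothFieldOn_of_mfderiv_eq contMDiff_bigProj
    (fun q => (𝓗.isCompl q).disjoint) hU hX (fun q _ => 𝓗.prH_mem q) fun q _ => ?_,
    fun q _ => 𝓗.prH_mem q⟩
  have h0 : mfderiv (J m) (𝓡 m) proj q (𝓗.prV X q) = 0 := 𝓗.prV_mem (X := X) q
  rw [← 𝓗.prH_add_prV (X := X) q, ContinuousLinearMap.map_add, h0, add_zero]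

theorem isSectionOn_prV (hU : IsOpen U) (hX : IsSmoothFieldOn X U) :
    IsSectionOn vertical (𝓗.prV X) U := by
  refine ⟨(hX.sub (𝓗.isSectionOn_prH hU hX).1).congr fun q _ => ?_, fun q _ => 𝓗.prV_mem q⟩
  exact eq_sub_of_add_eq' (𝓗.prH_add_prV (X := X) q)

end HorizontalBundle

variable {𝓗 : HorizontalBundle m M} {cov : Connection m M}

theorem IsBott.torsion_vertical_horizontal (h : IsBott 𝓗 cov) (q : Big m M) :
    ∀ u ∈ vertical q, ∀ v ∈ 𝓗.space q, cov.torsion q u v = 0 := fun u hu v hv => by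
  rw [cov.torsion_antisymm, h.torsion_eq_zero q v hv u hu, neg_zero]

theorem IsProjectableOn.normalizes (hU : IsOpen U) (hX : IsSmoothFieldOn X U)
    (hXp : IsProjectableOn X U) : Normalizes vertical U X :=
  fun _ hY _ hq => hXp.mlieBracket_mem_vertical hU hX hY hq

theorem IsBott.curvature_vertical_vertical (h : IsBott 𝓗 cov) (hcov : IsSmoothConnection cov)
    (hU : IsOpen U) {Y' : Π q : Big m M, TangentSpace (J m) q}
    (hY : IsSectionOn vertical Y U) (hY' : IsSectionOn vertical Y' U)
    (hX : IsSectionOn 𝓗.space X U) (hq : q ∈ U) : curvature cov Y Y' X q = 0 :=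
  curvature_eq_zero_of_isInvolutive hcov h.preserves_vertical h.preserves_horizontal
    (fun q => (𝓗.isCompl q).disjoint.symm) h.torsion_vertical_horizontal isInvolutive_vertical
    hU hY hY' hX hq

/-- With `A = ∇_X X'`, the curvature is `∇_Y A`, which is horizontal and differs from `[Y, A]` by
the vertical field `∇_A Y`. -/
theorem IsBott.curvature_vertical_horizontal (h : IsBott 𝓗 cov) (hcov : IsSmoothConnection cov)
    (hU : IsOpen U) (hY : IsSectionOn vertical Y U) (hX : IsSectionOn 𝓗.space X U)
    (hX' : IsSectionOn 𝓗.space X' U) (hXp : IsProjectableOn X U) (hXp' : IsProjectableOn X' U)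
    (hq : q ∈ U) :
    curvature cov Y X X' q = 𝓗.prH (mlieBracket (J m) Y (nabla cov X X')) q := by
  have hA := hcov.isSectionOn_nabla h.preserves_horizontal hU hX.1 hX'
  rw [curvature_eq_nabla_of_normalizes h.preserves_vertical h.preserves_horizontal
    (fun q => (𝓗.isCompl q).disjoint.symm) h.torsion_vertical_horizontal hU hY hX hX'
    (hXp.normalizes hU hX.1) (hXp'.normalizes hU hX'.1) hq]
  refine (𝓗.prH_eq_of_sub_mem (h.preserves_horizontal U hU _ hA q hq _) ?_).symm
  rw [mlieBracket_eq_of_torsion_eq_zero h.torsion_vertical_horizontal hU hY hA hq,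
    sub_right_comm, nabla, sub_self, zero_sub]
  exact (vertical q).neg_mem (h.preserves_vertical U hU _ hY q hq _)

theorem IsBott.curvature_horizontal_horizontal (h : IsBott 𝓗 cov) (hcov : IsSmoothConnection cov)
    (hU : IsOpen U) (hX : IsSectionOn 𝓗.space X U) (hX' : IsSectionOn 𝓗.space X' U)
    (hY : IsSectionOn vertical Y U) (hXp : IsProjectableOn X U) (hXp' : IsProjectableOn X' U)
    (hq : q ∈ U) :
    curvature cov X X' Y q = cov.torsion q (Y q) (𝓗.ehresmannCurvature X X' q)
      - nabla cov Y (𝓗.ehresmannCurvature X X') q := by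
  have hbr := hX.1.mlieBracket hU hX'.1
  have hV := 𝓗.isSectionOn_prV hU hbr
  -- The Ehresmann curvature brackets `pr_𝓗 X` and `pr_𝓗 X'`, which are known to agree with `X` and
  -- `X'` only on `U`.
  have hR : ∀ q ∈ U, 𝓗.prV (mlieBracket (J m) X X') q = 𝓗.ehresmannCurvature X X' q := by
    intro q hq
    simp only [HorizontalBundle.ehresmannCurvature, HorizontalBundle.prV]
    rw [mlieBracket_congr_of_isOpen hU hq (fun q hq => (𝓗.prH_eq_self (hX.2 q hq)).symm)
      (fun q hq => (𝓗.prH_eq_self (hX'.2 q hq)).symm)]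
  rw [nabla, ← cov_congr hU hq hV.1 hR, ← hR q hq]
  exact curvature_eq_torsion_sub_nabla hcov h.preserves_vertical h.preserves_horizontal
    (fun q => (𝓗.isCompl q).disjoint.symm) h.torsion_vertical_horizontal isInvolutive_vertical
    hU hY hX hX' (hXp.normalizes hU hX.1) (hXp'.normalizes hU hX'.1)
    (𝓗.isSectionOn_prH hU hbr) hV (funext fun q => (𝓗.prH_add_prV q).symm) hq

end BigTangent

end Lemmas

open SmoothGeometry BigTangent in
theorem proposition4p4 (m : ℕ) (M : Type*) [TopologicalSpace M]
    [ChartedSpace (EuclideanSpace ℝ (Fin m)) M] [IsManifold (𝓡 m) ∞ M]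
    (𝓗 : HorizontalBundle m M) (cov : Connection m M)
    (hsmooth : IsSmoothConnection cov) (hBott : IsBott 𝓗 cov) :
    -- `R(Y, Y') X = 0`
    (∀ (U : Set (Big m M)), IsOpen U → ∀ Y Y' X : Π q : Big m M, TangentSpace (J m) q,
      IsSectionOn vertical Y U → IsSectionOn vertical Y' U → IsSectionOn 𝓗.space X U →
      ∀ q ∈ U, curvature cov Y Y' X q = 0) ∧
    -- `R(Y, X) X' = pr_𝓗 [Y, ∇_X X']`
    (∀ (U : Set (Big m M)), IsOpen U → ∀ Y X X' : Π q : Big m M, TangentSpace (J m) q,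
      IsSectionOn vertical Y U → IsSectionOn 𝓗.space X U → IsSectionOn 𝓗.space X' U →
      IsProjectableOn X U → IsProjectableOn X' U →
      ∀ q ∈ U, curvature cov Y X X' q =
        𝓗.prH (VectorField.mlieBracket (J m) Y (nabla cov X X')) q) ∧
    -- `R(X, X') Y = T(Y, R_𝓗(X, X')) - ∇_Y (R_𝓗(X, X'))`
    (∀ (U : Set (Big m M)), IsOpen U → ∀ X X' Y : Π q : Big m M, TangentSpace (J m) q,
      IsSectionOn 𝓗.space X U → IsSectionOn 𝓗.space X' U → IsSectionOn vertical Y U →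
      IsProjectableOn X U → IsProjectableOn X' U →
      ∀ q ∈ U, curvature cov X X' Y q =
        cov.torsion q (Y q) (𝓗.ehresmannCurvature X X' q)
          - nabla cov Y (𝓗.ehresmannCurvature X X') q) ∧
    -- `R(Y_a, Y'_a) Y_{a'} = 0` for `{a, a'} = {1, 2}`
    (IsMultiBott 𝓗 cov →
      (∀ (U : Set (Big m M)), IsOpen U → ∀ Y Y' W : Π q : Big m M, TangentSpace (J m) q,
        IsSectionOn vertical₁ Y U → IsSectionOn vertical₁ Y' U → IsSectionOn vertical₂ W U →
        ∀ q ∈ U, curvature cov Y Y' W q = 0) ∧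
      (∀ (U : Set (Big m M)), IsOpen U → ∀ Y Y' W : Π q : Big m M, TangentSpace (J m) q,
        IsSectionOn vertical₂ Y U → IsSectionOn vertical₂ Y' U → IsSectionOn vertical₁ W U →
        ∀ q ∈ U, curvature cov Y Y' W q = 0)) :=
  ⟨fun _ hU _ _ _ hY hY' hX _ hq => hBott.curvature_vertical_vertical hsmooth hU hY hY' hX hq,
    fun _ hU _ _ _ hY hX hX' hXp hXp' _ hq =>
      hBott.curvature_vertical_horizontal hsmooth hU hY hX hX' hXp hXp' hq,
    fun _ hU _ _ _ hX hX' hY hXp hXp' _ hq =>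
      hBott.curvature_horizontal_horizontal hsmooth hU hX hX' hY hXp hXp' hq,
    fun h =>
      ⟨fun _ hU _ _ _ hY hY' hW _ hq =>
        curvature_eq_zero_of_isInvolutive hsmooth h.preserves_vertical₁ h.preserves_vertical₂
          disjoint_vertical₁_vertical₂ h.torsion_eq_zero₁₂ isInvolutive_vertical₁ hU hY hY' hW hq,
      fun _ hU _ _ _ hY hY' hW _ hq =>
        curvature_eq_zero_of_isInvolutive hsmooth h.preserves_vertical₂ h.preserves_vertical₁
          (fun q => (disjoint_vertical₁_vertical₂ q).symm) h.torsion_eq_zero₂₁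
          isInvolutive_vertical₂ hU hY hY' hW hq⟩⟩
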